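/- Let $\varphi$ be Euler's totient function, let $F_m=2^{2^m}+1$ ($m\ge 0$) be the Fermat numbers, and let $\mathcal S$ be the set of primes that divide some Fermat number. The infinite product \[ C=\prod_{l\in\mathcal S}\left(1-\frac1l\right) \] converges unconditionally to a strictly positive real number, and for every integer $n\ge 0$, with $q=2^{2^n}$, \[ \frac{\varphi(q-1)}{q-1}=\frac{\varphi(2^{2^n}-1)}{2^{2^n}-1}\ \ge\ C . \] In particular, $\varphi(q-1)/(q-1)$ is bounded below by a positive constant independent of $n$. -/

import Mathlib

/-- The set of primes that divide some Fermat number `F_m = 2 ^ (2 ^ m) + 1`, `m ≥ 0`. -/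
def fermatPrimeDivisors : Set ℕ :=
  {l : ℕ | l.Prime ∧ ∃ m : ℕ, l ∣ Nat.fermatNumber m}

/-! Since `2 ^ 2 ^ n - 1` is the product of the `F_k` with `k < n`, its totient ratio is a finite
subproduct of `C`, whose factors lie in `(0, 1)`; hence it is at least `C`. Convergence to a
positive limit reduces, via logarithms, to summability of `1 / l`. This holds because the primes
dividing `F_m` are few and all `≡ 1` mod `2 ^ (m + 1)`, so their reciprocals add up to `O(m / 2 ^
m)` (`sum_inv_primeFactors_fermatNumber_le`). -/

open Finset in
lemma card_primeFactors_fermatNumber_le (m : ℕ) :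
    #(Nat.fermatNumber m).primeFactors ≤ 2 ^ (m + 1) := by
  have h1 : 2 ^ #(Nat.fermatNumber m).primeFactors ≤ Nat.fermatNumber m := by
    refine le_trans (Finset.pow_card_le_prod _ (fun p => p) 2 fun p hp => ?_)
      (Nat.le_of_dvd ?_ (Nat.prod_primeFactors_dvd _))
    · exact (Nat.prime_of_mem_primeFactors hp).two_le
    · have := Nat.three_le_fermatNumber m
      omega
  have h2 : Nat.fermatNumber m ≤ 2 ^ 2 ^ (m + 1) := by
    have h3 : 2 ≤ 2 ^ 2 ^ m := Nat.le_self_pow (by positivity) 2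
    rw [Nat.fermatNumber, pow_succ 2 m, pow_mul]
    nlinarith
  exact (Nat.pow_le_pow_iff_right (by norm_num)).1 (h1.trans h2)

/-- Prime divisors of the `m`-th Fermat number are `k * 2 ^ (m + 1) + 1` with `k ≥ 1`. -/
lemma exists_eq_of_mem_primeFactors_fermatNumber {m p : ℕ}
    (hp : p ∈ (Nat.fermatNumber m).primeFactors) : ∃ k, 1 ≤ k ∧ p = k * 2 ^ (m + 1) + 1 := by
  have hpp := Nat.prime_of_mem_primeFactors hp
  have hpd := Nat.dvd_of_mem_primeFactors hp
  have hp2 : p ≠ 2 := by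
    rintro rfl
    exact (Nat.not_even_iff_odd.2 (Nat.odd_fermatNumber m)) (even_iff_two_dvd.2 hpd)
  obtain ⟨k, rfl⟩ := Nat.pow_pow_add_primeFactors_one_lt hpp hp2 hpd
  refine ⟨k, Nat.one_le_iff_ne_zero.2 ?_, rfl⟩
  rintro rfl
  simp [Nat.not_prime_one] at hpp

open Finset in
/-- A sum of reciprocals over a finite set of positive integers, cut at `N`. -/
lemma sum_inv_le_harmonic_add (K : Finset ℕ) (hK : ∀ k ∈ K, 1 ≤ k) {N : ℕ} (hN : 0 < N) :
    ∑ k ∈ K, (k : ℝ)⁻¹ ≤ harmonic N + #K / N := by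
  rw [← sum_filter_add_sum_filter_not K (· ≤ N)]
  have hN' : (0 : ℝ) < N := by exact_mod_cast hN
  refine add_le_add ?_ ?_
  · rw [harmonic_eq_sum_Icc]
    push_cast
    refine sum_le_sum_of_subset_of_nonneg (fun k hk => ?_) (fun _ _ _ => by positivity)
    rw [mem_filter] at hk
    exact mem_Icc.2 ⟨hK k hk.1, hk.2⟩
  · calc ∑ k ∈ K with ¬ k ≤ N, (k : ℝ)⁻¹ ≤ #{k ∈ K | ¬ k ≤ N} • (N : ℝ)⁻¹ := by
          refine sum_le_card_nsmul _ _ _ fun k hk => ?_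
          rw [mem_filter, not_le] at hk
          exact inv_anti₀ hN' (by exact_mod_cast hk.2.le)
      _ ≤ #K / N := by
          rw [nsmul_eq_mul, div_eq_mul_inv]
          gcongr
          exact filter_subset _ _

-- Writing `p = k * 2 ^ (m + 1) + 1` gives distinct `k ≥ 1`, at most `2 ^ (m + 1)` of them. Cutting
-- at `N = 2 ^ m`, the small `k` contribute at most `1 + m` to the sum of `1 / k` and the large ones
-- at most `2`.
open Finset in
lemma sum_inv_primeFactors_fermatNumber_le (m : ℕ) :
    ∑ p ∈ (Nat.fermatNumber m).primeFactors, (p : ℝ)⁻¹ ≤ (m + 3) * (1 / 2) ^ (m + 1) := by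
  set P := (Nat.fermatNumber m).primeFactors with hP
  have hk : ∀ p ∈ P, 1 ≤ p / 2 ^ (m + 1) ∧ p = p / 2 ^ (m + 1) * 2 ^ (m + 1) + 1 := by
    intro p hp
    obtain ⟨k, hk1, rfl⟩ := exists_eq_of_mem_primeFactors_fermatNumber hp
    have : (k * 2 ^ (m + 1) + 1) / 2 ^ (m + 1) = k := by
      rw [mul_comm, Nat.mul_add_div (by positivity),
        Nat.div_eq_of_lt (Nat.one_lt_two_pow (by omega)), add_zero]
    rw [this]
    exact ⟨hk1, rfl⟩
  have hinj : Set.InjOn (fun p => p / 2 ^ (m + 1)) (P : Set ℕ) := by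
    intro p hp q hq hpq
    rw [(hk p hp).2, (hk q hq).2]
    simp only at hpq
    rw [hpq]
  have hcard : #(P.image fun p => p / 2 ^ (m + 1)) ≤ 2 ^ (m + 1) :=
    card_image_le.trans (card_primeFactors_fermatNumber_le m)
  have hharm : ((harmonic (2 ^ m) : ℚ) : ℝ) ≤ 1 + m := by
    refine (harmonic_le_one_add_log _).trans ?_
    push_cast
    rw [Real.log_pow]
    have : Real.log 2 ≤ 1 := by linarith [Real.log_two_lt_d9]
    nlinarith [Nat.cast_nonneg (α := ℝ) m]
  have hsum := sum_inv_le_harmonic_add (P.image fun p => p / 2 ^ (m + 1))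
    (fun k h => by
      obtain ⟨p, hp, rfl⟩ := mem_image.1 h
      exact (hk p hp).1) (N := 2 ^ m) (by positivity)
  rw [sum_image hinj] at hsum
  have htail : (#(P.image fun p => p / 2 ^ (m + 1)) : ℝ) / (2 ^ m : ℕ) ≤ 2 := by
    rw [div_le_iff₀ (by positivity)]
    have : (#(P.image fun p => p / 2 ^ (m + 1)) : ℝ) ≤ 2 ^ (m + 1) := by exact_mod_cast hcard
    push_cast
    rw [pow_succ (2 : ℝ)] at this
    linarith
  calc ∑ p ∈ P, (p : ℝ)⁻¹
      ≤ ∑ p ∈ P, ((p / 2 ^ (m + 1) : ℕ) : ℝ)⁻¹ * (1 / 2) ^ (m + 1) := by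
        refine sum_le_sum fun p hp => ?_
        obtain ⟨h1, h2⟩ := hk p hp
        have h1' : (0 : ℝ) < ((p / 2 ^ (m + 1) : ℕ) : ℝ) := by exact_mod_cast h1
        rw [one_div, inv_pow, ← mul_inv]
        refine inv_anti₀ (by positivity) ?_
        exact_mod_cast (by omega : p / 2 ^ (m + 1) * 2 ^ (m + 1) ≤ p)
    _ = (∑ p ∈ P, ((p / 2 ^ (m + 1) : ℕ) : ℝ)⁻¹) * (1 / 2) ^ (m + 1) := by rw [sum_mul]
    _ ≤ (m + 3) * (1 / 2) ^ (m + 1) := by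
        gcongr
        linarith

/-- A nonnegative function is summable on a set covered by finite sets over which its sums are
bounded by a summable sequence. -/
lemma summable_subtype_of_sum_le {α ι : Type*} {g : α → ℝ} (hg : ∀ x, 0 ≤ g x) {P : ι → Finset α}
    {b : ι → ℝ} (hb : Summable b) (hP : ∀ m, ∑ x ∈ P m, g x ≤ b m) {S : Set α}
    (hS : ∀ x : S, ∃ m, (x : α) ∈ P m) : Summable fun x : S => g x := by
  have hσ : Summable fun x : Σ m : ι, P m => g x.2 := by
    rw [summable_sigma_of_nonneg fun _ => hg _]
    refine ⟨fun m => (hasSum_fintype _).summable, ?_⟩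
    refine Summable.of_nonneg_of_le (fun m => tsum_nonneg fun _ => hg _) (fun m => ?_) hb
    rw [tsum_fintype, Finset.sum_coe_sort (P m) g]
    exact hP m
  -- The `P m` may overlap; choosing one index for each point embeds `S` in their disjoint union.
  choose f hf using hS
  have he : Function.Injective fun x : S => (⟨f x, x, hf x⟩ : Σ m : ι, P m) := fun a b hab =>
    Subtype.ext (congrArg (fun x : Σ m : ι, P m => (x.2 : α)) hab)
  exact hσ.comp_injective he

/-- The reciprocals of the primes dividing Fermat numbers are summable. -/
lemma summable_inv_fermatPrimeDivisors :
    Summable fun l : fermatPrimeDivisors => ((l : ℕ) : ℝ)⁻¹ := by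
  have hb : Summable fun m : ℕ => ((m : ℝ) + 3) * (1 / 2) ^ (m + 1) := by
    have h0 : Summable fun m : ℕ => (1 / 2 : ℝ) ^ m :=
      summable_geometric_of_lt_one (by norm_num) (by norm_num)
    have h1 : Summable fun m : ℕ => (m : ℝ) ^ 1 * (1 / 2 : ℝ) ^ m :=
      summable_pow_mul_geometric_of_norm_lt_one 1 (by norm_num)
    refine ((h1.mul_left (1 / 2)).add (h0.mul_left (3 / 2))).congr fun m => ?_
    ring
  refine summable_subtype_of_sum_le (g := fun p : ℕ => (p : ℝ)⁻¹) (fun _ => by positivity) hb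
    sum_inv_primeFactors_fermatNumber_le ?_
  rintro ⟨l, hl, m, hm⟩
  refine ⟨m, Nat.mem_primeFactors.2 ⟨hl, hm, ?_⟩⟩
  have := Nat.three_le_fermatNumber m
  omega

lemma mem_fermatPrimeDivisors_of_mem_primeFactors {n p : ℕ}
    (hp : p ∈ (2 ^ 2 ^ n - 1).primeFactors) : p ∈ fermatPrimeDivisors := by
  have hpp := Nat.prime_of_mem_primeFactors hp
  have hpd := Nat.dvd_of_mem_primeFactors hp
  have h : 2 ^ 2 ^ n - 1 = ∏ k ∈ Finset.range n, Nat.fermatNumber k := by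
    rw [Nat.prod_fermatNumber, Nat.fermatNumber]
    omega
  rw [h] at hpd
  obtain ⟨k, -, hk⟩ := (Prime.dvd_finsetProd_iff hpp.prime _).1 hpd
  exact ⟨hpp, k, hk⟩

lemma totient_div_self_eq_prod {n : ℕ} (hn : n ≠ 0) :
    (Nat.totient n : ℝ) / n = ∏ p ∈ n.primeFactors, (1 - 1 / (p : ℝ)) := by
  have h := congrArg (Rat.cast : ℚ → ℝ) (Nat.totient_eq_mul_prod_factors n)
  push_cast at h
  have hn' : (n : ℝ) ≠ 0 := by exact_mod_cast hn
  rw [h, mul_div_cancel_left₀ _ hn']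
  simp only [one_div]

/-- An infinite product with factors in `[0, 1]` is at most each of its finite subproducts. -/
lemma HasProd.le_prod_of_le_one {ι : Type*} {f : ι → ℝ} {a : ℝ} (h : HasProd f a)
    (h0 : ∀ i, 0 ≤ f i) (h1 : ∀ i, f i ≤ 1) (s : Finset ι) : a ≤ ∏ i ∈ s, f i := by
  classical
  refine le_of_tendsto h ?_
  simp only [SummationFilter.unconditional_filter]
  filter_upwards [Filter.eventually_ge_atTop s] with t ht
  rw [← Finset.prod_sdiff ht]
  exact mul_le_of_le_one_left (Finset.prod_nonneg fun i _ => h0 i)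
    (Finset.prod_le_one (fun i _ => h0 i) fun i _ => h1 i)

theorem mainTheorem7 :
    ∃ C : ℝ, 0 < C ∧
      HasProd (fun l : fermatPrimeDivisors => 1 - 1 / ((l : ℕ) : ℝ)) C ∧
      ∀ n : ℕ, C ≤ (Nat.totient (2 ^ (2 ^ n) - 1) : ℝ) / ((2 ^ (2 ^ n) - 1 : ℕ) : ℝ) := by
  have hpos : ∀ l : fermatPrimeDivisors, 0 < 1 - 1 / ((l : ℕ) : ℝ) := fun l => by
    have : (1 : ℝ) < (l : ℕ) := by exact_mod_cast l.2.1.one_lt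
    rw [sub_pos, div_lt_one (by linarith)]
    exact this
  have hle : ∀ l : fermatPrimeDivisors, 1 - 1 / ((l : ℕ) : ℝ) ≤ 1 := fun l =>
    sub_le_self _ (by positivity)
  have hlog : Summable fun l : fermatPrimeDivisors => Real.log (1 - 1 / ((l : ℕ) : ℝ)) :=
    (Real.summable_log_one_add_of_summable summable_inv_fermatPrimeDivisors.neg).congr
      fun l => by rw [one_div, sub_eq_add_neg]
  have hprod := Real.hasProd_of_hasSum_log hpos hlog.hasSum
  refine ⟨_, Real.exp_pos _, hprod, fun n => ?_⟩
  have h2 : 2 ≤ 2 ^ 2 ^ n := Nat.le_self_pow (by positivity) 2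
  rw [totient_div_self_eq_prod (by omega), ← Finset.prod_attach]
  let e : (2 ^ 2 ^ n - 1).primeFactors ↪ fermatPrimeDivisors :=
    ⟨fun p => ⟨p, mem_fermatPrimeDivisors_of_mem_primeFactors p.2⟩,
      fun p q h => Subtype.ext (congrArg (fun x : fermatPrimeDivisors => (x : ℕ)) h)⟩
  refine (hprod.le_prod_of_le_one (fun l => (hpos l).le) hle
    ((2 ^ 2 ^ n - 1).primeFactors.attach.map e)).trans_eq ?_
  rw [Finset.prod_map]
  rfl
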